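/- Let $\Gamma$ be a group acting by isometries on a complete CAT(0) space $X$, let $d$ and $k_0$ be positive integers, and suppose that $X$ has topological dimension at most $d$, in the sense that for every closed subspace $K\subseteq X$ and every $r\ge d$, each continuous map $K\to\mathbb S^r$ extends to a continuous map $X\to\mathbb S^r$. Let $\Lambda\le\Gamma$ be a subgroup with a finite generating set $\mathcal A$ that has ample duplication for dimension $d$, with base $k_0$; that is, there is a function $f:\mathbb N\to\mathbb N$ such that 1. each subset $S\subseteq\mathcal A$ with $|S|>k_0$ either can be written as a disjoint union $S=S_1\sqcup S_2$ where $S_1,S_2$ are non-empty and $\langle S_1\rangle$ normalizes $\langle S_2\rangle$, or else there are at least $f(|S|)$ distinct conjugates of $\langle S\rangle$ in $\Gamma$ that commute with each other (every element of one commutes with every element of any other); and 2. $d<(k-1)\,f(k)$ for $k=k_0+1,\dots,\min\{d+1,|\mathcal A|\}$. If the subgroup $\langle S\rangle$ has a fixed point in $X$ for every $S\subseteq\mathcal A$ with $|S|\le k_0$, then $\Lambda$ has a fixed point in $X$. -/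

import Mathlib

/-- `c` restricts to a geodesic `[0,1] → X` from `x` to `y`, parameterized proportional to arc
length. Only the values of `c` on `[0,1]` matter. -/
def IsGeodesic {X : Type*} [MetricSpace X] (c : ℝ → X) (x y : X) : Prop :=
  c 0 = x ∧ c 1 = y ∧
    ∀ s ∈ Set.Icc (0 : ℝ) 1, ∀ t ∈ Set.Icc (0 : ℝ) 1, dist (c s) (c t) = |s - t| * dist x y

/-- `X` is a CAT(0) space: it is a geodesic space, and every geodesic triangle is at least as thin
as its comparison triangles in the Euclidean plane. Here `p, q, r` are the vertices of the triangle,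
`p', q', r'` those of a comparison triangle, and the points compared lie on two sides with common
vertex `p`; any two distinct sides of a triangle are of this form. The comparison point of `c₁ s`
on the segment from `p'` to `q'` is the point at parameter `s`. -/
structure IsCAT0 (X : Type*) [MetricSpace X] : Prop where
  exists_geodesic : ∀ x y : X, ∃ c : ℝ → X, IsGeodesic c x y
  comparison : ∀ (p q r : X) (c₁ c₂ : ℝ → X), IsGeodesic c₁ p q → IsGeodesic c₂ p r →
    ∀ p' q' r' : EuclideanSpace ℝ (Fin 2),
      dist p' q' = dist p q → dist p' r' = dist p r → dist q' r' = dist q r →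
      ∀ s ∈ Set.Icc (0 : ℝ) 1, ∀ t ∈ Set.Icc (0 : ℝ) 1,
        dist (c₁ s) (c₂ t) ≤ dist (AffineMap.lineMap p' q' s) (AffineMap.lineMap p' r' t)

/-- The unit sphere of dimension `r`. -/
abbrev UnitSphere (r : ℕ) : Type :=
  Metric.sphere (0 : EuclideanSpace ℝ (Fin (r + 1))) 1

/-- `dim X ≤ d`: every continuous map from a closed subspace of `X` to a sphere of dimension
`r ≥ d` extends continuously to `X`. -/
def DimLE (X : Type*) [TopologicalSpace X] (d : ℕ) : Prop :=
  ∀ K : Set X, IsClosed K → ∀ r : ℕ, d ≤ r → ∀ f : C(K, UnitSphere r),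
    ∃ g : C(X, UnitSphere r), ∀ x : K, g x = f x

/-- `S` is a disjoint union of non-empty sets `S₁`, `S₂` such that `⟨S₁⟩` normalizes `⟨S₂⟩`. -/
def SplitsNormalizing {Γ : Type*} [Group Γ] (S : Set Γ) : Prop :=
  ∃ S₁ S₂ : Set Γ, S₁.Nonempty ∧ S₂.Nonempty ∧ Disjoint S₁ S₂ ∧ S = S₁ ∪ S₂ ∧
    Subgroup.closure S₁ ≤ Subgroup.normalizer (Subgroup.closure S₂ : Set Γ)

/-- There are at least `n` (distinct) conjugates of `H` in `Γ` that commute with each other, i.e.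
each element of one commutes with each element of any other. -/
def HasCommutingConjugates {Γ : Type*} [Group Γ] (H : Subgroup Γ) (n : ℕ) : Prop :=
  ∃ L : Fin n → Subgroup Γ, Function.Injective L ∧
    (∀ i, ∃ g : Γ, L i = H.map (MulAut.conj g).toMonoidHom) ∧
    ∀ i j, i ≠ j → ∀ a ∈ L i, ∀ b ∈ L j, a * b = b * a

/-- The finite subset `A` of `Γ` (a generating set of some subgroup of `Γ`) has ample duplication
for dimension `d`, with base `k₀`. Conjugates are taken in the ambient group `Γ`. -/
def HasAmpleDuplication {Γ : Type*} [Group Γ] (A : Finset Γ) (d k₀ : ℕ) : Prop :=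
  ∃ f : ℕ → ℕ,
    (∀ S : Finset Γ, S ⊆ A → k₀ < S.card →
      SplitsNormalizing (S : Set Γ) ∨
        HasCommutingConjugates (Subgroup.closure (S : Set Γ)) (f S.card)) ∧
    ∀ k : ℕ, k₀ + 1 ≤ k → k ≤ min (d + 1) A.card → d < (k - 1) * f k

/-! Induction on |S| shows that every S ⊆ A has a common fixed point in X. When S splits, the fixed
set of S₂ is a closed convex set preserved by ⟨S₁⟩, so projecting onto it a fixed point of S₁ gives
a point fixed by S.

Otherwise write |S| = l + 1 and conjugate S by g₁, ..., gₙ so that the conjugates commute. The fixed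
sets C i j of the conjugated generators form n families of l + 1 closed convex sets. Omitting one
set from each family leaves a non-empty intersection: proper subsets of S have fixed points, and
commuting families with fixed points share one. If d < n * l, a Helly-type theorem
(`exists_iInter_nonempty_of_dimLE`) makes some whole family intersect; conjugating back, S has a
fixed point.

For that theorem, suppose that no family intersects. Normalized distances to the sets map X to a
product P of n simplices of dimension l, and barycenters give a map from P to X sending each facet
into the corresponding C i j. On the union of the C i j, radial projection from the center of P is a
map to a sphere of dimension n * l - 1 ≥ d, so it extends to X. Composing gives a map from P to that
sphere which keeps each facet on its own side, contradicting Brouwer's theorem. -/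

open MeasureTheory Metric Set Filter Topology

/-! ### Brouwer's fixed point theorem, by the change of variables formula -/

section Brouwer

variable {E : Type*} [NormedAddCommGroup E] [InnerProductSpace ℝ E]

/-- A segment leaving the ball crosses the bounding sphere, where `g` vanishes, so the estimate
inside the ball suffices. -/
theorem lipschitzWith_indicator_closedBall {g : E → E} {M : ℝ} {C : NNReal}
    (hg : LipschitzOnWith C g (closedBall 0 M)) (hz : ∀ x, ‖x‖ = M → g x = 0) :
    LipschitzWith C ((closedBall (0 : E) M).indicator g) := by
  have key : ∀ x y : E, x ∈ closedBall (0 : E) M → y ∉ closedBall (0 : E) M →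
      dist (g x) 0 ≤ C * dist x y := by
    intro x y hx hy
    rw [mem_closedBall_zero_iff] at hx hy
    obtain ⟨s, hs, hsM⟩ : M ∈ (fun s : ℝ => ‖AffineMap.lineMap x y s‖) '' Icc 0 1 := by
      refine intermediate_value_Icc zero_le_one ?_ ?_
      · exact (AffineMap.lineMap_continuous.norm).continuousOn
      · simp only [AffineMap.lineMap_apply_zero, AffineMap.lineMap_apply_one]
        exact ⟨hx, (not_le.1 hy).le⟩
    have h0 := hz _ hsM
    rw [← h0]
    refine (hg.dist_le_mul x (by simpa) _ (by simpa using hsM.le)).trans ?_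
    gcongr
    rw [dist_left_lineMap, Real.norm_of_nonneg hs.1]
    exact mul_le_of_le_one_left dist_nonneg hs.2
  refine LipschitzWith.of_dist_le_mul fun x y => ?_
  by_cases hx : x ∈ closedBall (0 : E) M <;> by_cases hy : y ∈ closedBall (0 : E) M
  · simpa [indicator_of_mem hx, indicator_of_mem hy] using hg.dist_le_mul x hx y hy
  · simpa only [indicator_of_mem hx, indicator_of_notMem hy] using key x y hx hy
  · rw [indicator_of_notMem hx, indicator_of_mem hy, dist_comm, dist_comm x y]
    exact key y x hy hx
  · rw [indicator_of_notMem hx, indicator_of_notMem hy, dist_self]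
    positivity

variable [FiniteDimensional ℝ E]

/-- Differentiating ‖ρ‖² shows that the range of `ρ'` is orthogonal to the non-zero vector `ρ x`. -/
theorem det_eq_zero_of_norm_eq {ρ : E → E} {ρ' : E →L[ℝ] E} {x : E} {c : ℝ}
    (hρ : HasFDerivAt ρ ρ' x) (hc : c ≠ 0) (hn : ∀ y, ‖ρ y‖ = c) : ρ'.det = 0 := by
  by_contra hdet
  have hsurj : Function.Surjective ρ' :=
    (LinearMap.equivOfDetNeZero (ρ' : E →ₗ[ℝ] E) hdet).surjective
  obtain ⟨v, hv⟩ := hsurj (ρ x)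
  have h1 := hρ.inner ℝ hρ
  have h2 : (fun y => inner ℝ (ρ y) (ρ y)) = fun _ => c ^ 2 := by
    funext y
    rw [real_inner_self_eq_norm_sq, hn]
  rw [h2] at h1
  have h3 := congrArg (fun L : E →L[ℝ] ℝ => L v) (h1.unique (hasFDerivAt_const _ _))
  simp [fderivInnerCLM_apply, hv, hn, hc] at h3

theorem exists_lagrange_weights (m : ℕ) {ε : ℝ} (hε : 0 < ε) :
    ∃ t w : Fin (m + 1) → ℝ, (∀ j, 0 < t j ∧ t j < ε) ∧
      ∀ p : Polynomial ℝ, p.natDegree ≤ m → p.eval 1 = ∑ j, w j * p.eval (t j) := by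
  let t : Fin (m + 1) → ℝ := fun j => ε * ((j + 1 : ℝ) / (m + 2))
  have ht : Function.Injective t := by
    intro i j hij
    have h2 : (m + 2 : ℝ) ≠ 0 := by positivity
    simp only [t] at hij
    field_simp at hij
    exact Fin.ext (by exact_mod_cast add_right_cancel hij)
  refine ⟨t, fun j => (Lagrange.basis Finset.univ t j).eval 1, fun j => ⟨by positivity, ?_⟩, ?_⟩
  · have : (j + 1 : ℝ) / (m + 2) < 1 := by
      rw [div_lt_one (by positivity)]
      have : (j : ℝ) < m + 1 := by exact_mod_cast j.2
      linarith
    calc ε * ((j + 1 : ℝ) / (m + 2)) < ε * 1 := by gcongr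
      _ = ε := mul_one _
  · intro p hp
    have hdeg : p.degree < (Finset.univ : Finset (Fin (m + 1))).card := by
      rw [Finset.card_univ, Fintype.card_fin]
      exact lt_of_le_of_lt Polynomial.degree_le_natDegree (by exact_mod_cast Nat.lt_succ_of_le hp)
    conv_lhs => rw [Lagrange.eq_interpolate ht.injOn hdeg]
    rw [Lagrange.interpolate_apply, Polynomial.eval_finsetSum]
    refine Finset.sum_congr rfl fun j _ => ?_
    rw [Polynomial.eval_mul, Polynomial.eval_C, mul_comm]

theorem exists_polynomial_det (A : E →L[ℝ] E) :
    ∃ p : Polynomial ℝ, p.natDegree ≤ Module.finrank ℝ E ∧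
      ∀ t : ℝ, p.eval t = (ContinuousLinearMap.id ℝ E + t • A).det := by
  let b := Module.finBasis ℝ E
  let N := LinearMap.toMatrix b b (A : E →ₗ[ℝ] E)
  refine ⟨Matrix.det ((Polynomial.X : Polynomial ℝ) • N.map Polynomial.C +
    (1 : Matrix _ _ ℝ).map Polynomial.C), ?_, fun t => ?_⟩
  · simpa using Polynomial.natDegree_det_X_add_C_le N 1
  · have h1 : (ContinuousLinearMap.id ℝ E + t • A).det =
        (LinearMap.toMatrix b b ((ContinuousLinearMap.id ℝ E + t • A : E →L[ℝ] E) :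
          E →ₗ[ℝ] E)).det := (LinearMap.det_toMatrix b _).symm
    rw [h1, ← Polynomial.coe_evalRingHom, RingHom.map_det]
    congr 1
    ext i j
    simp [N, LinearMap.toMatrix_apply, Matrix.one_apply]
    simp only [Finsupp.single_apply, eq_comm (a := j), apply_ite, Polynomial.eval_one,
      Polynomial.eval_zero]
    split_ifs <;> ring

/-- With `g` extended by zero, `t • g` is a contraction, so x + t g(x) is a bijection of E. It is
the identity off the ball, hence permutes the ball. -/
theorem image_ball_add_smul {g : E → E} {M : ℝ} {C : NNReal} {t : ℝ}
    (hg : LipschitzOnWith C g (closedBall 0 M)) (hz : ∀ x, ‖x‖ = M → g x = 0)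
    (ht : 0 ≤ t) (htC : t * C < 1) :
    InjOn (fun x => x + t • g x) (ball 0 M) ∧
      (fun x => x + t • g x) '' ball 0 M = ball 0 M := by
  set G := (closedBall (0 : E) M).indicator g with hG
  have hGl : LipschitzWith C G := lipschitzWith_indicator_closedBall hg hz
  have hGg : ∀ x ∈ ball (0 : E) M, G x = g x := fun x hx =>
    indicator_of_mem (ball_subset_closedBall hx) g
  have hG0 : ∀ x ∉ ball (0 : E) M, G x = 0 := by
    intro x hx
    by_cases h : x ∈ closedBall (0 : E) M
    · rw [hG, indicator_of_mem h]
      rw [mem_closedBall_zero_iff] at h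
      rw [mem_ball_zero_iff, not_lt] at hx
      exact hz x (le_antisymm h hx)
    · exact indicator_of_notMem h g
  have hcon : ∀ y, ContractingWith (t.toNNReal * C) fun x => y - t • G x := by
    refine fun y => ⟨?_, ?_⟩
    · rw [← NNReal.coe_lt_coe]
      simpa [Real.coe_toNNReal t ht] using htC
    · refine LipschitzWith.of_dist_le_mul fun a b => ?_
      rw [dist_sub_left, dist_smul₀, Real.norm_of_nonneg ht]
      rw [NNReal.coe_mul, Real.coe_toNNReal t ht, mul_assoc]
      exact mul_le_mul_of_nonneg_left (hGl.dist_le_mul a b) ht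
  have hinj : ∀ a b, a + t • G a = b + t • G b → a = b := by
    intro a b hab
    refine (hcon (a + t • G a)).fixedPoint_unique' (x := a) (y := b) ?_ ?_
    · simp [Function.IsFixedPt]
    · simp [Function.IsFixedPt, hab]
  have hsurj : ∀ y, ∃ x, x + t • G x = y := by
    intro y
    have h := (hcon y).fixedPoint_isFixedPt
    exact ⟨_, (eq_sub_iff_add_eq.1 h.symm)⟩
  refine ⟨fun a ha b hb hab => hinj a b ?_, ?_⟩
  · rw [hGg a ha, hGg b hb]; exact hab
  · ext y
    constructor
    · rintro ⟨x, hx, rfl⟩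
      by_contra hy
      have h1 : x + t • g x = x := by
        apply hinj
        rw [hG0 _ hy, hGg x hx, smul_zero, add_zero]
      exact hy (by simpa only [h1] using hx)
    · intro hy
      obtain ⟨x, hx⟩ := hsurj y
      by_cases hxb : x ∈ ball (0 : E) M
      · exact ⟨x, hxb, by rw [← hx, hGg x hxb]⟩
      · rw [hG0 x hxb, smul_zero, add_zero] at hx
        exact absurd (hx ▸ hy) hxb

/-- Put g = ρ - id. For small t the map id + t g permutes the ball, so the integral of its Jacobian
is the volume of the ball. The Jacobian is polynomial in t, so the same holds at t = 1; but there
the map is ρ, whose Jacobian vanishes. -/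
theorem not_exists_contDiff_retraction_sphere {ρ : E → E} {M : ℝ} (hM : 0 < M)
    (hρ : ContDiff ℝ 1 ρ) (hn : ∀ x, ‖ρ x‖ = M) (hid : ∀ x, ‖x‖ = M → ρ x = x) : False := by
  let _ : MeasurableSpace E := borel E
  have _ : BorelSpace E := ⟨rfl⟩
  let g : E → E := fun x => ρ x - x
  have hgc : ContDiff ℝ 1 g := hρ.sub contDiff_id
  let A : E → E →L[ℝ] E := fderiv ℝ g
  have hA : Continuous A := hgc.continuous_fderiv one_ne_zero
  have hgA : ∀ x, HasFDerivAt g (A x) x := fun x =>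
    (hgc.differentiable one_ne_zero x).hasFDerivAt
  have hz : ∀ x, ‖x‖ = M → g x = 0 := fun x hx => by simp [g, hid x hx]
  obtain ⟨C', hC'⟩ := (isCompact_closedBall (0 : E) M).exists_bound_of_continuousOn
    hA.continuousOn
  set C : NNReal := C'.toNNReal with hC
  have hAC : ∀ x ∈ closedBall (0 : E) M, ‖A x‖ ≤ C := fun x hx =>
    (hC' x hx).trans (Real.le_coe_toNNReal C')
  have hgl : LipschitzOnWith C g (closedBall 0 M) :=
    (convex_closedBall (0 : E) M).lipschitzOnWith_of_nnnorm_fderiv_le (𝕜 := ℝ)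
      (fun x _ => (hgc.differentiable one_ne_zero x)) (fun x hx => hAC x hx)
  obtain ⟨δ, hδ, hdet⟩ : ∃ δ > 0, ∀ B : E →L[ℝ] E, dist B (ContinuousLinearMap.id ℝ E) < δ →
      0 < B.det := by
    have h1 : ContinuousAt (fun B : E →L[ℝ] E => B.det) (ContinuousLinearMap.id ℝ E) :=
      ContinuousLinearMap.continuous_det.continuousAt
    have h2 : (0 : ℝ) < (ContinuousLinearMap.id ℝ E).det := by
      simp [ContinuousLinearMap.det]
    exact Metric.eventually_nhds_iff.1 (h1.eventually (lt_mem_nhds h2))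
  have hC1 : (0 : ℝ) < C + 1 := by positivity
  -- Interpolation nodes so small that `t j * C` is below 1 (bijectivity) and below δ (positive
  -- Jacobian).
  obtain ⟨t, w, ht, hw⟩ := exists_lagrange_weights (Module.finrank ℝ E)
    (ε := min 1 δ / (C + 1)) (by positivity)
  let D : ℝ → E → ℝ := fun s x => (ContinuousLinearMap.id ℝ E + s • A x).det
  have hDc : ∀ s, Continuous (D s) := fun s =>
    ContinuousLinearMap.continuous_det.comp (continuous_const.add (hA.const_smul s))
  have hDi : ∀ s, IntegrableOn (D s) (ball 0 M) := fun s =>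
    ((hDc s).continuousOn.integrableOn_compact (isCompact_closedBall (0 : E) M)).mono_set
      ball_subset_closedBall
  have hvol : ∀ j, ∫ x in ball (0 : E) M, D (t j) x = volume.real (ball (0 : E) M) := by
    intro j
    obtain ⟨ht0, ht1⟩ := ht j
    have htm : t j * C < min 1 δ := by
      rw [lt_div_iff₀ hC1] at ht1
      nlinarith
    obtain ⟨hinj, himg⟩ := image_ball_add_smul hgl hz ht0.le (htm.trans_le (min_le_left _ _))
    have hcv := integral_image_eq_integral_abs_det_fderiv_smul volume
      (s := ball (0 : E) M) (f := fun x => x + t j • g x)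
      (f' := fun x => ContinuousLinearMap.id ℝ E + t j • A x) measurableSet_ball
      (fun x _ => ((hasFDerivAt_id x).add ((hgA x).const_smul (t j))).hasFDerivWithinAt) hinj
      (fun _ => (1 : ℝ))
    rw [himg] at hcv
    simp only [smul_eq_mul, mul_one, setIntegral_const] at hcv
    rw [hcv]
    refine setIntegral_congr_fun measurableSet_ball fun x hx => ?_
    refine (abs_of_pos (hdet _ ?_)).symm
    rw [dist_eq_norm, add_sub_cancel_left, norm_smul, Real.norm_of_nonneg ht0.le]
    calc t j * ‖A x‖ ≤ t j * C := by
          gcongr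
          exact hAC x (ball_subset_closedBall hx)
      _ < δ := htm.trans_le (min_le_right _ _)
  have hw1 : ∑ j, w j = 1 := by
    have := hw 1 (by simp)
    simpa using this.symm
  have hD1 : ∀ x, D 1 x = ∑ j, w j * D (t j) x := by
    intro x
    obtain ⟨p, hp, hpe⟩ := exists_polynomial_det (A x)
    simp only [D, ← hpe]
    exact hw p hp
  have hD0 : ∀ x, D 1 x = 0 := by
    intro x
    have h1 : HasFDerivAt ρ (ContinuousLinearMap.id ℝ E + (1 : ℝ) • A x) x := by
      have := (hasFDerivAt_id x).add (hgA x)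
      rw [one_smul]
      convert! this using 1
      funext y
      simp [g]
    exact det_eq_zero_of_norm_eq h1 hM.ne' hn
  have h0 : ∫ x in ball (0 : E) M, D 1 x = volume.real (ball (0 : E) M) := by
    simp_rw [hD1]
    rw [integral_finsetSum _ fun j _ => (hDi (t j)).const_mul (w j)]
    simp_rw [integral_const_mul, hvol]
    rw [← Finset.sum_mul, hw1, one_mul]
  simp_rw [hD0] at h0
  have hpos : 0 < volume.real (ball (0 : E) M) :=
    ENNReal.toReal_pos (measure_ball_pos _ _ hM).ne' measure_ball_lt_top.ne
  simp at h0
  linarith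

theorem exists_eq_self_of_continuous_of_norm_le {f : E → E} (hf : Continuous f) {R : ℝ}
    (hR : ∀ x, ‖f x‖ ≤ R) : ∃ x, f x = x := by
  by_contra! hne
  have hR0 : 0 ≤ R := (norm_nonneg _).trans (hR 0)
  obtain ⟨Q, hQ, hfQ⟩ : ∃ Q > 0, ∀ x, ‖f x‖ < Q :=
    ⟨R + 1, by linarith, fun x => (hR x).trans_lt (lt_add_one R)⟩
  -- The cutoff is 1 for ‖x‖ ≤ Q and 0 for ‖x‖ ≥ 2Q. A zero of `h` beyond radius Q is excluded by ‖f
  -- x‖ < Q, and one within it would be a fixed point of `f`.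
  let χ : E → ℝ := fun x => max 0 (min 1 (2 - ‖x‖ / Q))
  have hχ0 : ∀ x, 0 ≤ χ x := fun x => le_max_left _ _
  have hχ1 : ∀ x, χ x ≤ 1 := fun x => max_le zero_le_one (min_le_left _ _)
  let h : E → E := fun x => x - χ x • f x
  have hh : Continuous h := by fun_prop
  have h_ne : ∀ x, h x ≠ 0 := by
    intro x hx
    rw [sub_eq_zero] at hx
    rcases le_or_gt ‖x‖ Q with hxQ | hxQ
    · have : χ x = 1 := by
        have : ‖x‖ / Q ≤ 1 := (div_le_one hQ).2 hxQ
        simp only [χ]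
        rw [min_eq_left (by linarith), max_eq_right zero_le_one]
      rw [this, one_smul] at hx
      exact hne x hx.symm
    · have : ‖x‖ < Q := by
        rw [hx, norm_smul, Real.norm_of_nonneg (hχ0 x)]
        exact (mul_le_of_le_one_left (norm_nonneg _) (hχ1 x)).trans_lt (hfQ x)
      linarith
  have h_far : ∀ x, 2 * Q < ‖x‖ → h x = x := by
    intro x hx
    have h2 : 2 - ‖x‖ / Q ≤ 0 := by
      rw [sub_nonpos, le_div_iff₀ hQ]; exact hx.le
    have : χ x = 0 := max_eq_left ((min_le_right _ _).trans h2)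
    simp [h, this]
  have hUo : IsOpen {x : E | 2 * Q < ‖x‖} := isOpen_lt continuous_const continuous_norm
  have hSc : IsClosed {x : E | 3 * Q ≤ ‖x‖} := isClosed_le continuous_const continuous_norm
  -- The strict error bound ‖h x‖ keeps the smooth approximation non-zero, so it can be normalized
  -- to a retraction onto the sphere of radius 3Q.
  obtain ⟨k, hk, hkd, hkS, -⟩ := hh.exists_contDiff_approx_and_eqOn (ε := fun x => ‖h x‖) 1
    hh.norm (fun x => norm_pos_iff.2 (h_ne x)) hSc
    (hUo.mem_nhdsSet.2 (fun x (hx : 3 * Q ≤ ‖x‖) => show 2 * Q < ‖x‖ by linarith))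
    (contDiffOn_id.congr fun x hx => h_far x hx)
  have hk_ne : ∀ x, k x ≠ 0 := by
    intro x hx
    have := hkd x
    rw [hx, dist_zero_left] at this
    exact lt_irrefl _ this
  refine not_exists_contDiff_retraction_sphere (ρ := fun x => (3 * Q * ‖k x‖⁻¹) • k x)
    (M := 3 * Q) (by positivity) ?_ ?_ ?_
  · exact ContDiff.smul (contDiff_const.mul ((hk.norm ℝ hk_ne).inv fun x =>
      norm_ne_zero_iff.2 (hk_ne x))) hk
  · intro x
    have := norm_ne_zero_iff.2 (hk_ne x)
    rw [norm_smul, norm_mul, norm_inv, norm_norm, mul_assoc, inv_mul_cancel₀ this,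
      Real.norm_of_nonneg (by positivity), mul_one]
  · intro x hx
    have h1 : k x = x := (hkS (show 3 * Q ≤ ‖x‖ from hx.ge)).trans (h_far x (by linarith))
    simp only [h1]
    rw [hx, mul_inv_cancel₀ (by positivity), one_smul]

end Brouwer

/-! ### CAT(0) geometry: midpoints, projections and barycenters -/

theorem exists_euclidean_triangle {a b c : ℝ} (ha : 0 ≤ a) (hb : 0 ≤ b) (hc : 0 ≤ c)
    (h₁ : a ≤ b + c) (h₂ : b ≤ a + c) (h₃ : c ≤ a + b) :
    ∃ p q r : EuclideanSpace ℝ (Fin 2), dist p q = a ∧ dist p r = b ∧ dist q r = c := by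
  rcases ha.eq_or_lt with rfl | ha
  · refine ⟨!₂[0, 0], !₂[0, 0], !₂[b, 0], by simp, ?_, ?_⟩
    · simp [EuclideanSpace.dist_eq, Real.sqrt_sq_eq_abs, abs_of_nonneg hb]
    · simp [EuclideanSpace.dist_eq, Real.sqrt_sq_eq_abs, abs_of_nonneg hb]
      linarith
  · let x := (a ^ 2 + b ^ 2 - c ^ 2) / (2 * a)
    have hx : 2 * a * x = a ^ 2 + b ^ 2 - c ^ 2 := by simp only [x]; field_simp
    have hxb : 0 ≤ b ^ 2 - x ^ 2 := by
      have h1 : x ≤ b := by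
        by_contra! h
        nlinarith [mul_lt_mul_of_pos_left h ha]
      have h2 : -b ≤ x := by
        by_contra! h
        nlinarith [mul_lt_mul_of_pos_left h ha]
      nlinarith
    refine ⟨!₂[0, 0], !₂[a, 0], !₂[x, √(b ^ 2 - x ^ 2)], ?_, ?_, ?_⟩
    · simp [EuclideanSpace.dist_eq, Real.sqrt_sq_eq_abs, abs_of_nonneg ha.le]
    · simp [EuclideanSpace.dist_eq, Real.sq_sqrt hxb, Real.sqrt_sq_eq_abs, abs_of_nonneg hb,
        Real.dist_eq]
    · have : (a - x) ^ 2 + (b ^ 2 - x ^ 2) = c ^ 2 := by linarith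
      simp [EuclideanSpace.dist_eq, Real.sq_sqrt hxb, Real.dist_eq, this, Real.sqrt_sq_eq_abs,
        abs_of_nonneg hc]

section CN

variable {X : Type*} [MetricSpace X]

/-- `m` is a midpoint of `x` and `y` in the sense of the Bruhat–Tits (CN) inequality. -/
def IsCNMidpoint (x y m : X) : Prop :=
  ∀ p, dist p m ^ 2 ≤ (dist p x ^ 2 + dist p y ^ 2) / 2 - dist x y ^ 2 / 4

/-- The Bruhat–Tits (CN) inequality. -/
def HasCNMidpoints (X : Type*) [MetricSpace X] : Prop :=
  ∀ x y : X, ∃ m, IsCNMidpoint x y m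

theorem IsCAT0.hasCNMidpoints (hX : IsCAT0 X) : HasCNMidpoints X := by
  intro x y
  obtain ⟨c, hc⟩ := hX.exists_geodesic x y
  refine ⟨c (1 / 2), fun p => ?_⟩
  obtain ⟨c₁, hc₁⟩ := hX.exists_geodesic x p
  obtain ⟨x', p', y', hxp, hxy, hpy⟩ := exists_euclidean_triangle
    (dist_nonneg (x := x) (y := p)) (dist_nonneg (x := x) (y := y)) (dist_nonneg (x := p) (y := y))
    (by simpa only [dist_comm p y] using dist_triangle x y p) (dist_triangle x p y)
    (by simpa only [dist_comm p x] using dist_triangle p x y)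
  -- Parameter 1 on the side from `x` to `p` is the vertex `p` itself; Apollonius' identity then
  -- evaluates the Euclidean median.
  have h := hX.comparison x p y c₁ c hc₁ hc x' p' y' hxp hxy hpy 1 (by norm_num) (1 / 2)
    (by norm_num)
  rw [hc₁.2.1, AffineMap.lineMap_apply_one] at h
  have hm : (AffineMap.lineMap x' y' (1 / 2 : ℝ)) = midpoint ℝ x' y' := by
    simp [midpoint]
  rw [hm] at h
  have hap := EuclideanGeometry.dist_sq_add_dist_sq_eq_two_mul_dist_midpoint_sq_add_half_dist_sq
    p' x' y'
  rw [dist_comm p' x', hxp, hpy, hxy] at hap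
  have h2 : dist p (c (1 / 2)) ^ 2 ≤ dist p' (midpoint ℝ x' y') ^ 2 := by gcongr
  rw [dist_comm p x]
  linarith

namespace IsCNMidpoint

variable {x y m : X}

theorem dist_left_le (h : IsCNMidpoint x y m) : dist x m ≤ dist x y / 2 := by
  have := h x
  rw [dist_self] at this
  exact abs_le_of_sq_le_sq' (by linarith) (by positivity) |>.2

theorem dist_right_le (h : IsCNMidpoint x y m) : dist y m ≤ dist x y / 2 := by
  have := h y
  rw [dist_self, dist_comm y x] at this
  exact abs_le_of_sq_le_sq' (by linarith) (by positivity) |>.2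

theorem eq_of_dist_le (h : IsCNMidpoint x y m) {p : X} (hx : dist p x ≤ dist x y / 2)
    (hy : dist p y ≤ dist x y / 2) : p = m := by
  have h1 := h p
  have h2 : dist p x ^ 2 ≤ (dist x y / 2) ^ 2 := by gcongr
  have h3 : dist p y ^ 2 ≤ (dist x y / 2) ^ 2 := by gcongr
  have h4 : dist p m ^ 2 = 0 := le_antisymm (by linarith) (sq_nonneg _)
  exact dist_eq_zero.1 (pow_eq_zero_iff two_ne_zero |>.1 h4)

end IsCNMidpoint

/-- Closed convex sets, where convexity is expressed through midpoints. -/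
structure IsClosedCNConvex (C : Set X) : Prop where
  isClosed : IsClosed C
  mem_of_isCNMidpoint : ∀ x ∈ C, ∀ y ∈ C, ∀ m, IsCNMidpoint x y m → m ∈ C

theorem IsClosedCNConvex.univ : IsClosedCNConvex (univ : Set X) :=
  ⟨isClosed_univ, fun _ _ _ _ _ _ => mem_univ _⟩

theorem IsClosedCNConvex.iInter {ι : Sort*} {C : ι → Set X} (h : ∀ i, IsClosedCNConvex (C i)) :
    IsClosedCNConvex (⋂ i, C i) :=
  ⟨isClosed_iInter fun i => (h i).isClosed, fun x hx y hy m hm => mem_iInter.2 fun i =>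
    (h i).mem_of_isCNMidpoint x (mem_iInter.1 hx i) y (mem_iInter.1 hy i) m hm⟩

variable [CompleteSpace X]

/-- Strong convexity makes a minimizing sequence Cauchy. It also gives quadratic growth at the
minimizer, which serves below as a quantitative form of uniqueness. -/
theorem exists_strong_minimizer (hX : HasCNMidpoints X) {C : Set X} (hC : IsClosedCNConvex C)
    (hne : C.Nonempty) {F : X → ℝ} (hF : Continuous F) (h0 : ∀ x, 0 ≤ F x)
    (hconv : ∀ x y m, IsCNMidpoint x y m → F m ≤ (F x + F y) / 2 - dist x y ^ 2 / 4) :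
    ∃ b ∈ C, ∀ y ∈ C, F b + dist b y ^ 2 ≤ F y := by
  set I := sInf (F '' C) with hI
  have hbdd : BddBelow (F '' C) := ⟨0, by rintro _ ⟨x, -, rfl⟩; exact h0 x⟩
  have hIle : ∀ x ∈ C, I ≤ F x := fun x hx => csInf_le hbdd (mem_image_of_mem F hx)
  have hseq : ∀ n : ℕ, ∃ x ∈ C, F x < I + 1 / (n + 1) := by
    intro n
    obtain ⟨_, ⟨x, hx, rfl⟩, h⟩ := exists_lt_of_csInf_lt (hne.image F)
      (lt_add_of_pos_right I (Nat.one_div_pos_of_nat (α := ℝ) (n := n)))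
    exact ⟨x, hx, h⟩
  choose u huC huF using hseq
  have hcauchy : CauchySeq u := by
    refine cauchySeq_of_le_tendsto_0 (fun N : ℕ => √(4 * (1 / (N + 1 : ℝ)))) ?_ ?_
    · intro n m N hn hm
      obtain ⟨z, hz⟩ := hX (u n) (u m)
      have h1 := hconv _ _ _ hz
      have h2 := hIle z (hC.mem_of_isCNMidpoint _ (huC n) _ (huC m) z hz)
      have h3 := Nat.one_div_le_one_div (α := ℝ) hn
      have h4 := Nat.one_div_le_one_div (α := ℝ) hm
      refine Real.le_sqrt_of_sq_le ?_
      linarith [huF n, huF m]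
    · have := (tendsto_one_div_add_atTop_nhds_zero_nat (𝕜 := ℝ)).const_mul 4
      simpa using this.sqrt
  obtain ⟨b, hb⟩ := cauchySeq_tendsto_of_complete hcauchy
  have hbC : b ∈ C := hC.isClosed.mem_of_tendsto hb (Eventually.of_forall huC)
  have hbI : F b ≤ I := by
    refine le_of_tendsto_of_tendsto' ((hF.tendsto b).comp hb)
      (by simpa using (tendsto_one_div_add_atTop_nhds_zero_nat (𝕜 := ℝ)).const_add I)
      fun n => (huF n).le
  -- Applying the bound to the midpoint of `b` and `y` improves the constant from c to (1 + c) / 2.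
  have key : ∀ n : ℕ, ∀ y ∈ C, F b + (1 - (1 / 2) ^ n) * dist b y ^ 2 ≤ F y := by
    intro n
    induction n with
    | zero => intro y hy; simpa using hbI.trans (hIle y hy)
    | succ n ih =>
      intro y hy
      obtain ⟨m, hm⟩ := hX b y
      have h1 := hconv _ _ _ hm
      have h2 := ih m (hC.mem_of_isCNMidpoint _ hbC _ hy m hm)
      have h3 : dist b y / 2 ≤ dist b m := by
        have := dist_triangle_right b y m
        linarith [hm.dist_right_le]
      have h4 : (dist b y / 2) ^ 2 ≤ dist b m ^ 2 := by gcongr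
      have h5 : (0 : ℝ) ≤ 1 - (1 / 2) ^ n := by
        rw [sub_nonneg]; exact pow_le_one₀ (by norm_num) (by norm_num)
      have h6 := mul_le_mul_of_nonneg_left h4 h5
      rw [pow_succ]
      linarith
  refine ⟨b, hbC, fun y hy => ?_⟩
  have hlim : Tendsto (fun n : ℕ => F b + (1 - (1 / 2 : ℝ) ^ n) * dist b y ^ 2) atTop
      (𝓝 (F b + (1 - 0) * dist b y ^ 2)) :=
    ((tendsto_const_nhds.sub (tendsto_pow_atTop_nhds_zero_of_lt_one (by norm_num)
      (by norm_num))).mul_const _).const_add _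
  simpa using le_of_tendsto' hlim fun n => key n y hy

theorem IsClosedCNConvex.exists_projection (hX : HasCNMidpoints X) {C : Set X}
    (hC : IsClosedCNConvex C) (hne : C.Nonempty) (p : X) :
    ∃ b ∈ C, ∀ y ∈ C, dist p b ^ 2 + dist b y ^ 2 ≤ dist p y ^ 2 :=
  exists_strong_minimizer hX hC hne (F := fun y => dist p y ^ 2) (by fun_prop)
    (fun _ => sq_nonneg _) fun _ _ _ hm => hm p

/-- The barycenter minimizes the weighted sum of squared distances. It lies in C because projecting
to C does not increase the distance to any point of C. -/
theorem exists_barycenter (hX : HasCNMidpoints X) {ι : Type*} [Fintype ι] (x : ι → X) :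
    ∃ β : stdSimplex ℝ ι → X, Continuous β ∧ ∀ (w : stdSimplex ℝ ι) (C : Set X),
      IsClosedCNConvex C → (∀ i, w.1 i ≠ 0 → x i ∈ C) → β w ∈ C := by
  let F : stdSimplex ℝ ι → X → ℝ := fun w y => ∑ i, w.1 i * dist (x i) y ^ 2
  have hmin : ∀ w, ∃ b, ∀ y, F w b + dist b y ^ 2 ≤ F w y := by
    intro w
    have hι : Nonempty ι := by
      by_contra h
      rw [not_nonempty_iff] at h
      simpa using w.2.2
    have hconv : ∀ y z m, IsCNMidpoint y z m →
        F w m ≤ (F w y + F w z) / 2 - dist y z ^ 2 / 4 := by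
      intro y z m hm
      calc F w m ≤ ∑ i, w.1 i * ((dist (x i) y ^ 2 + dist (x i) z ^ 2) / 2 - dist y z ^ 2 / 4) :=
            Finset.sum_le_sum fun i _ => mul_le_mul_of_nonneg_left (hm (x i)) (w.2.1 i)
        _ = (F w y + F w z) / 2 - (∑ i, w.1 i) * (dist y z ^ 2 / 4) := by
            simp only [F]
            rw [Finset.sum_mul, ← Finset.sum_add_distrib, Finset.sum_div,
              ← Finset.sum_sub_distrib]
            exact Finset.sum_congr rfl fun i _ => by ring
        _ = _ := by rw [w.2.2, one_mul]
    obtain ⟨b, -, hb⟩ := exists_strong_minimizer hX (F := F w) IsClosedCNConvex.univ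
      ⟨x hι.some, mem_univ _⟩ (by fun_prop)
      (fun y => Finset.sum_nonneg fun i _ => mul_nonneg (w.2.1 i) (sq_nonneg _)) hconv
    exact ⟨b, fun y => hb y (mem_univ y)⟩
  choose β hβ using hmin
  refine ⟨β, ?_, ?_⟩
  · let D : ℝ := ∑ i, ∑ j, dist (x i) (x j) ^ 2
    have hD : ∀ w j, dist (β w) (x j) ^ 2 ≤ D := by
      intro w j
      have h1 : 0 ≤ F w (β w) :=
        Finset.sum_nonneg fun i _ => mul_nonneg (w.2.1 i) (sq_nonneg _)
      have h2 : F w (x j) ≤ D := by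
        refine Finset.sum_le_sum fun i _ => ?_
        have h3 : w.1 i ≤ 1 := by
          rw [← w.2.2]
          exact Finset.single_le_sum (fun k _ => w.2.1 k) (Finset.mem_univ i)
        exact (mul_le_of_le_one_left (sq_nonneg _) h3).trans
          (Finset.single_le_sum (f := fun j => dist (x i) (x j) ^ 2)
            (fun _ _ => sq_nonneg _) (Finset.mem_univ j))
      linarith [hβ w (x j)]
    have hdist : ∀ v w, dist (β v) (β w) ≤ √(∑ i, |v.1 i - w.1 i| * D) := by
      intro v w
      refine Real.le_sqrt_of_sq_le ?_
      have h1 := hβ v (β w)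
      have h2 := hβ w (β v)
      rw [dist_comm] at h2
      -- Adding the growth inequalities of the two minimizers leaves only differences of weights,
      -- times distances bounded by `D`.
      have h3 : F v (β w) - F w (β w) + (F w (β v) - F v (β v)) ≤
          2 * ∑ i, |v.1 i - w.1 i| * D := by
        simp only [F]
        rw [← Finset.sum_sub_distrib, ← Finset.sum_sub_distrib, ← Finset.sum_add_distrib,
          Finset.mul_sum]
        refine Finset.sum_le_sum fun i _ => ?_
        have h4 := hD v i
        have h5 := hD w i
        rw [dist_comm] at h4 h5
        have h6 := mul_le_mul_of_nonneg_left h5 (abs_nonneg (v.1 i - w.1 i))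
        have h7 := mul_le_mul_of_nonneg_left h4 (abs_nonneg (v.1 i - w.1 i))
        have h8 := mul_le_mul_of_nonneg_right (le_abs_self (v.1 i - w.1 i))
          (sq_nonneg (dist (x i) (β w)))
        have h9 := mul_le_mul_of_nonneg_right (neg_le_abs (v.1 i - w.1 i))
          (sq_nonneg (dist (x i) (β v)))
        linarith
      linarith
    refine continuous_iff_continuousAt.2 fun w => tendsto_iff_dist_tendsto_zero.2 ?_
    refine squeeze_zero (fun _ => dist_nonneg) (fun v => hdist v w) ?_
    have hcoord : ∀ i, Continuous fun v : stdSimplex ℝ ι => v.1 i := fun i =>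
      (continuous_apply i).comp continuous_subtype_val
    have hc : Continuous fun v : stdSimplex ℝ ι => √(∑ i, |v.1 i - w.1 i| * D) :=
      (continuous_finsetSum _ fun i _ =>
        ((hcoord i).sub continuous_const).abs.mul continuous_const).sqrt
    simpa using hc.tendsto w
  · intro w C hC hx
    have hne : C.Nonempty := by
      have : ∃ i ∈ Finset.univ, w.1 i ≠ 0 :=
        Finset.exists_ne_zero_of_sum_ne_zero (by rw [w.2.2]; exact one_ne_zero)
      obtain ⟨i, -, hi⟩ := this
      exact ⟨x i, hx i hi⟩
    obtain ⟨b, hbC, hb⟩ := hC.exists_projection hX hne (β w)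
    have h1 : F w b ≤ F w (β w) := by
      refine Finset.sum_le_sum fun i _ => ?_
      by_cases hi : w.1 i = 0
      · simp [hi]
      · refine mul_le_mul_of_nonneg_left ?_ (w.2.1 i)
        have := hb (x i) (hx i hi)
        rw [dist_comm (x i), dist_comm (x i)]
        linarith [sq_nonneg (dist (β w) b)]
    have h2 : dist (β w) b ^ 2 = 0 := le_antisymm (by linarith [hβ w b]) (sq_nonneg _)
    rw [dist_eq_zero.1 (pow_eq_zero_iff two_ne_zero |>.1 h2)]
    exact hbC

end CN

/-! ### Fixed sets of isometries -/

section Action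

variable {Γ X : Type*} [Group Γ] [MetricSpace X] [MulAction Γ X] [IsIsometricSMul Γ X]

theorem isClosedCNConvex_fixedBy (g : Γ) : IsClosedCNConvex (MulAction.fixedBy X g) := by
  refine ⟨isClosed_eq (continuous_const_smul g) continuous_id, fun x hx y hy m hm => ?_⟩
  rw [MulAction.mem_fixedBy] at hx hy ⊢
  refine hm.eq_of_dist_le ?_ ?_
  · have := hm.dist_left_le
    rwa [← dist_smul g, hx, dist_comm] at this
  · have := hm.dist_right_le
    rwa [← dist_smul g, hy, dist_comm] at this

variable [CompleteSpace X]

/-- The projection of `p` to C is fixed: `t` moves it to a point of C equally far from `p`, and the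
nearest point is unique. -/
theorem IsClosedCNConvex.exists_fixed (hX : HasCNMidpoints X) {C : Set X}
    (hC : IsClosedCNConvex C) (hne : C.Nonempty) {T : Set Γ} {p : X}
    (hp : ∀ t ∈ T, t • p = p) (hT : ∀ t ∈ T, ∀ x ∈ C, t • x ∈ C) :
    ∃ b ∈ C, ∀ t ∈ T, t • b = b := by
  obtain ⟨b, hbC, hb⟩ := hC.exists_projection hX hne p
  refine ⟨b, hbC, fun t ht => ?_⟩
  have h1 := hb (t • b) (hT t ht b hbC)
  have h2 : dist p (t • b) = dist p b := by
    conv_lhs => rw [← hp t ht, dist_smul]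
  rw [h2] at h1
  have h3 : dist b (t • b) ^ 2 = 0 := le_antisymm (by linarith) (sq_nonneg _)
  exact (dist_eq_zero.1 (pow_eq_zero_iff two_ne_zero |>.1 h3)).symm

end Action

/-! ### Linear coordinates on a product of simplices -/

section Coordinates

variable {n l N : ℕ} (e : Fin n × Fin l ≃ Fin N)

/-- The vector `v`, read as an `n × l` matrix, completed by a column making all row sums zero. -/
def rowExtend (v : EuclideanSpace ℝ (Fin N)) (i : Fin n) : Fin (l + 1) → ℝ :=
  Fin.cons (-∑ j, v (e (i, j))) fun j => v (e (i, j))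

/-- The left inverse of `rowExtend` that forgets the first column. -/
def rowRestrict (q : Fin n → Fin (l + 1) → ℝ) : EuclideanSpace ℝ (Fin N) :=
  WithLp.toLp 2 fun a => q (e.symm a).1 (e.symm a).2.succ

theorem sum_rowExtend (v : EuclideanSpace ℝ (Fin N)) (i : Fin n) :
    ∑ j, rowExtend e v i j = 0 := by
  simp [rowExtend, Fin.sum_univ_succ]

theorem rowExtend_smul (c : ℝ) (v : EuclideanSpace ℝ (Fin N)) (i : Fin n) (j : Fin (l + 1)) :
    rowExtend e (c • v) i j = c * rowExtend e v i j := by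
  refine Fin.cases ?_ (fun j => ?_) j
  · simp [rowExtend, Finset.mul_sum]
  · simp [rowExtend]

theorem continuous_rowExtend (i : Fin n) (j : Fin (l + 1)) :
    Continuous fun v => rowExtend e v i j := by
  refine Fin.cases ?_ (fun j => ?_) j
  · simp only [rowExtend, Fin.cons_zero]
    fun_prop
  · simp only [rowExtend, Fin.cons_succ]
    fun_prop

theorem rowExtend_rowRestrict {q : Fin n → Fin (l + 1) → ℝ} (hq : ∀ i, ∑ j, q i j = 0)
    (i : Fin n) (j : Fin (l + 1)) : rowExtend e (rowRestrict e q) i j = q i j := by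
  refine Fin.cases ?_ (fun j => ?_) j
  · have := hq i
    rw [Fin.sum_univ_succ] at this
    simp only [rowExtend, rowRestrict, Fin.cons_zero, Equiv.symm_apply_apply]
    linarith
  · simp [rowExtend, rowRestrict]

theorem exists_rowExtend_pos {v : EuclideanSpace ℝ (Fin N)} (hv : v ≠ 0) :
    ∃ i j, 0 < rowExtend e v i j := by
  by_contra! h
  refine hv (PiLp.ext fun a => ?_)
  have h1 := (Finset.sum_eq_zero_iff_of_nonpos fun j _ => h (e.symm a).1 j).1
    (sum_rowExtend e v (e.symm a).1) (e.symm a).2.succ (Finset.mem_univ _)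
  simpa [rowExtend] using h1

theorem exists_continuous_max_rowExtend [NeZero n] :
    ∃ μ : EuclideanSpace ℝ (Fin N) → ℝ, Continuous μ ∧ (∀ v, v ≠ 0 → 0 < μ v) ∧
      ∀ v, ∃ i j, rowExtend e v i j = μ v := by
  have hN : (Finset.univ : Finset (Fin n × Fin (l + 1))).Nonempty := Finset.univ_nonempty
  refine ⟨fun v => Finset.univ.sup' hN fun a => rowExtend e v a.1 a.2,
    Continuous.finset_sup'_apply hN fun a _ => continuous_rowExtend e a.1 a.2,
    fun v hv => ?_, fun v => ?_⟩
  · obtain ⟨i, j, hij⟩ := exists_rowExtend_pos e hv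
    exact hij.trans_le (Finset.le_sup' (fun a : Fin n × Fin (l + 1) => rowExtend e v a.1 a.2)
      (Finset.mem_univ (i, j)))
  · obtain ⟨a, -, ha⟩ := Finset.exists_mem_eq_sup' hN fun a => rowExtend e v a.1 a.2
    exact ⟨a.1, a.2, ha.symm⟩

/-- A map from a Euclidean space to its unit sphere points outward at some point of the boundary of
the polytope where all the coordinates `rowExtend` are at least `-κ`. -/
theorem exists_rowExtend_eq_neg [NeZero n] {r : ℕ} (e : Fin n × Fin l ≃ Fin (r + 1)) (κ : ℝ)
    {G : EuclideanSpace ℝ (Fin (r + 1)) → UnitSphere r} (hG : Continuous G) :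
    ∃ v i j, rowExtend e v i j = -κ ∧ 0 < rowExtend e (G v).1 i j := by
  obtain ⟨μ, hμc, hμ0, hμ⟩ := exists_continuous_max_rowExtend e
  have hs0 : ∀ s : UnitSphere r, 0 < μ s.1 := fun s =>
    hμ0 s.1 (ne_zero_of_mem_unit_sphere s)
  -- For κ > 0, scaling by -κ / μ sends s to the boundary point of the polytope in direction -s: its
  -- largest coordinate becomes -κ. Brouwer's theorem applies to this map after `G`.
  have hμs : Continuous fun s : UnitSphere r => -(κ / μ s.1) :=
    (continuous_const.div (hμc.comp continuous_subtype_val) fun s => (hs0 s).ne').neg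
  have hτ : Continuous fun s : UnitSphere r => (-(κ / μ s.1)) • s.1 :=
    hμs.smul continuous_subtype_val
  obtain ⟨R, hR⟩ := (isCompact_range hτ).isBounded.exists_norm_le
  obtain ⟨v, hv⟩ := exists_eq_self_of_continuous_of_norm_le
    (hτ.comp hG) (R := R) fun v => hR _ (mem_range_self _)
  obtain ⟨i, j, hij⟩ := hμ (G v).1
  refine ⟨v, i, j, ?_, hij ▸ hs0 (G v)⟩
  have h1 := congrArg (fun w => rowExtend e w i j) hv
  simp only [Function.comp_apply, rowExtend_smul, hij] at h1
  rw [← h1, neg_mul, div_mul_cancel₀ _ (hs0 (G v)).ne']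

end Coordinates

/-! ### A Helly-type theorem for several families of convex sets -/

section Nerve

variable {X : Type*} [MetricSpace X]

theorem exists_continuous_coordinates {n k : ℕ} {C : Fin n → Fin k → Set X}
    (hC : ∀ i j, IsClosed (C i j)) (hne : ∀ i j, (C i j).Nonempty)
    (hempty : ∀ i, ⋂ j, C i j = ∅) :
    ∃ ψ : X → Fin n → Fin k → ℝ, (∀ i j, Continuous fun x => ψ x i j) ∧
      (∀ x i, ∑ j, ψ x i j = 1) ∧ ∀ x i j, x ∈ C i j → ψ x i j = 0 := by
  have hs : ∀ x i, 0 < ∑ j, infDist x (C i j) := by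
    intro x i
    refine lt_of_le_of_ne (Finset.sum_nonneg fun _ _ => infDist_nonneg) fun h => ?_
    have h1 := (Finset.sum_eq_zero_iff_of_nonneg fun j _ => infDist_nonneg).1 h.symm
    have h2 : x ∈ ⋂ j, C i j := mem_iInter.2 fun j =>
      ((hC i j).mem_iff_infDist_zero (hne i j)).2 (h1 j (Finset.mem_univ j))
    rw [hempty i] at h2
    exact h2
  refine ⟨fun x i j => infDist x (C i j) / ∑ j', infDist x (C i j'), fun i j => ?_,
    fun x i => ?_, fun x i j hx => ?_⟩
  · exact (continuous_infDist_pt _).div (continuous_finsetSum _ fun j' _ =>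
      continuous_infDist_pt _) fun x => (hs x i).ne'
  · rw [← Finset.sum_div, div_self (hs x i).ne']
  · simp only [infDist_zero_of_mem hx, zero_div]

/-- Choose a point for each vertex α of the product of simplices and take barycenters with product
weights. If `b y i j = 0`, only vertices with α i ≠ j carry weight, and their points lie in `C i j`.
-/
theorem exists_continuous_map_of_faces [CompleteSpace X] (hX : HasCNMidpoints X) {Y : Type*}
    [TopologicalSpace Y] {n k : ℕ} {C : Fin n → Fin k → Set X}
    (hC : ∀ i j, IsClosedCNConvex (C i j))
    (hne : ∀ α : Fin n → Fin k, (⋂ i, ⋂ j, ⋂ (_ : j ≠ α i), C i j).Nonempty)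
    {b : Y → Fin n → Fin k → ℝ} (hb : ∀ i j, Continuous fun y => b y i j)
    (hb0 : ∀ y i j, 0 ≤ b y i j) (hb1 : ∀ y i, ∑ j, b y i j = 1) :
    ∃ Φ : Y → X, Continuous Φ ∧ ∀ y i j, b y i j = 0 → Φ y ∈ C i j := by
  choose x hx using hne
  obtain ⟨β, hβ, hβC⟩ := exists_barycenter hX x
  let W : Y → stdSimplex ℝ (Fin n → Fin k) := fun y =>
    ⟨fun α => ∏ i, b y i (α i), fun α => Finset.prod_nonneg fun i _ => hb0 y i _, by
      have := Finset.prod_univ_sum (fun _ : Fin n => (Finset.univ : Finset (Fin k)))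
        fun i j => b y i j
      rw [Fintype.piFinset_univ] at this
      rw [← this]
      exact Finset.prod_eq_one fun i _ => hb1 y i⟩
  have hW : Continuous W := Continuous.subtype_mk (continuous_pi fun α =>
    continuous_finsetProd _ fun i _ => hb i _) _
  refine ⟨fun y => β (W y), hβ.comp hW, fun y i j hij => hβC _ _ (hC i j) fun α hα => ?_⟩
  have h1 : b y i (α i) ≠ 0 := Finset.prod_ne_zero_iff.1 hα i (Finset.mem_univ i)
  have h2 : j ≠ α i := fun h => h1 (h ▸ hij)
  exact mem_iInter.1 (mem_iInter.1 (mem_iInter.1 (hx α) i) j) h2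

theorem exists_iInter_nonempty_of_dimLE [CompleteSpace X] (hX : HasCNMidpoints X) {d n l : ℕ}
    (hdim : DimLE X d) (hd : d < n * l) {C : Fin n → Fin (l + 1) → Set X}
    (hC : ∀ i j, IsClosedCNConvex (C i j))
    (hne : ∀ α : Fin n → Fin (l + 1), (⋂ i, ⋂ j, ⋂ (_ : j ≠ α i), C i j).Nonempty) :
    ∃ i, (⋂ j, C i j).Nonempty := by
  by_contra! hempty
  obtain ⟨r, hr⟩ : ∃ r, n * l = r + 1 := Nat.exists_eq_succ_of_ne_zero (by lia)
  have hdr : d ≤ r := by lia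
  have : NeZero n := ⟨by rintro rfl; simp at hr⟩
  have hl : l ≠ 0 := by rintro rfl; simp at hr
  have hnC : ∀ i j, (C i j).Nonempty := by
    intro i j
    have : Nontrivial (Fin (l + 1)) := Fin.nontrivial_iff_two_le.2 (by lia)
    obtain ⟨j', hj'⟩ := exists_ne j
    obtain ⟨x, hx⟩ := hne fun _ => j'
    exact ⟨x, mem_iInter.1 (mem_iInter.1 (mem_iInter.1 hx i) j) hj'.symm⟩
  let e : Fin n × Fin l ≃ Fin (r + 1) := finProdFinEquiv.trans (finCongr hr)
  obtain ⟨ψ, hψc, hψ1, hψ0⟩ :=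
    exists_continuous_coordinates (fun i j => (hC i j).isClosed) hnC hempty
  -- Each barycentric coordinate of the center of the simplex; subtracting it makes the row sums
  -- zero.
  let κ : ℝ := 1 / (l + 1)
  have hκ : 0 < κ := by positivity
  have hκ1 : ∑ _j : Fin (l + 1), κ = 1 := by
    simp only [Finset.sum_const, Finset.card_univ, Fintype.card_fin, nsmul_eq_mul, κ]
    push_cast
    field_simp
  let u : X → EuclideanSpace ℝ (Fin (r + 1)) := fun x => rowRestrict e fun i j => ψ x i j - κ
  have hu : Continuous u := by
    refine (PiLp.continuous_toLp 2 _).comp (continuous_pi fun a => ?_)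
    exact (hψc _ _).sub continuous_const
  have hLu : ∀ x i j, rowExtend e (u x) i j = ψ x i j - κ := fun x =>
    rowExtend_rowRestrict e fun i => by rw [Finset.sum_sub_distrib, hψ1, hκ1, sub_self]
  let K : Set X := ⋃ i, ⋃ j, C i j
  have hK : IsClosed K := isClosed_iUnion_of_finite fun i => isClosed_iUnion_of_finite fun j =>
    (hC i j).isClosed
  have hCK : ∀ x i j, x ∈ C i j → x ∈ K := fun x i j hx => mem_iUnion₂.2 ⟨i, j, hx⟩
  have hu0 : ∀ x ∈ K, u x ≠ 0 := by
    intro x hx h0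
    obtain ⟨i, j, hij⟩ := mem_iUnion₂.1 hx
    have h1 := hLu x i j
    have h2 := rowExtend_smul e 0 (u x) i j
    rw [zero_smul, zero_mul, ← h0, h1, hψ0 x i j hij] at h2
    linarith
  let f : C(K, UnitSphere r) :=
    { toFun := fun x => ⟨‖u x‖⁻¹ • u x, by
        rw [mem_sphere_zero_iff_norm, norm_smul, norm_inv, norm_norm,
          inv_mul_cancel₀ (norm_ne_zero_iff.2 (hu0 x x.2))]⟩
      continuous_toFun := by
        have h1 : Continuous fun x : K => u x := hu.comp continuous_subtype_val
        exact Continuous.subtype_mk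
          ((h1.norm.inv₀ fun x => norm_ne_zero_iff.2 (hu0 x x.2)).smul h1) _ }
  obtain ⟨g, hg⟩ := hdim K hK r hdr f
  -- Truncating and normalizing maps the whole space to the product of simplices, sending coordinate
  -- -κ to the facet where the barycentric coordinate is 0.
  let c : EuclideanSpace ℝ (Fin (r + 1)) → Fin n → Fin (l + 1) → ℝ :=
    fun v i j => max 0 (κ + rowExtend e v i j)
  have hcc : ∀ i j, Continuous fun v => c v i j := fun i j =>
    continuous_const.max (continuous_const.add (continuous_rowExtend e i j))
  have hc0 : ∀ v i, 0 < ∑ j, c v i j := by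
    intro v i
    calc (0 : ℝ) < ∑ j, (κ + rowExtend e v i j) := by
          rw [Finset.sum_add_distrib, sum_rowExtend, hκ1]; norm_num
      _ ≤ ∑ j, c v i j := Finset.sum_le_sum fun j _ => le_max_right _ _
  obtain ⟨Φ, hΦ, hΦC⟩ := exists_continuous_map_of_faces hX hC hne
    (b := fun v i j => c v i j / ∑ j', c v i j')
    (fun i j => (hcc i j).div (continuous_finsetSum _ fun j' _ => hcc i j')
      fun v => (hc0 v i).ne')
    (fun v i j => div_nonneg (le_max_left _ _) (hc0 v i).le)
    (fun v i => by rw [← Finset.sum_div, div_self (hc0 v i).ne'])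
  obtain ⟨v, i, j, hvij, hpos⟩ := exists_rowExtend_eq_neg e κ (g.continuous.comp hΦ)
  have hcv : c v i j = 0 := by
    simp only [c, hvij, add_neg_cancel, max_self]
  have hmem : Φ v ∈ C i j := hΦC v i j (by simp only [hcv, zero_div])
  have hgf : (g (Φ v) : EuclideanSpace ℝ (Fin (r + 1))) = ‖u (Φ v)‖⁻¹ • u (Φ v) :=
    congrArg Subtype.val (hg ⟨Φ v, hCK _ i j hmem⟩)
  -- On `C i j` the coordinate of `u` is -κ < 0, while the point given by Brouwer's theorem makes it
  -- positive.
  rw [Function.comp_apply, hgf, rowExtend_smul, hLu, hψ0 _ i j hmem, zero_sub] at hpos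
  have h1 : 0 ≤ ‖u (Φ v)‖⁻¹ := by positivity
  nlinarith

end Nerve

/-! ### Fixed points of generating subsets -/

section FixedPoints

variable {Γ X : Type*} [Group Γ]

theorem smul_eq_of_mem_closure [MulAction Γ X] {S : Set Γ} {p : X} (hp : ∀ s ∈ S, s • p = p)
    {g : Γ} (hg : g ∈ Subgroup.closure S) : g • p = p := by
  have h : Subgroup.closure S ≤ MulAction.stabilizer Γ p :=
    (Subgroup.closure_le _).2 fun s hs => hp s hs
  exact h hg

theorem fixedPoints_closure_nonempty_iff [MulAction Γ X] {S : Set Γ} :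
    (MulAction.fixedPoints (Subgroup.closure S) X).Nonempty ↔ ∃ p : X, ∀ s ∈ S, s • p = p :=
  ⟨fun ⟨p, hp⟩ => ⟨p, fun s hs => hp ⟨s, Subgroup.subset_closure hs⟩⟩,
    fun ⟨p, hp⟩ => ⟨p, fun g => smul_eq_of_mem_closure hp g.2⟩⟩

theorem hasCommutingConjugates_one (H : Subgroup Γ) : HasCommutingConjugates H 1 :=
  ⟨fun _ => H, Function.injective_of_subsingleton _,
    fun _ => ⟨1, by
      rw [map_one]
      exact (Subgroup.map_id H).symm⟩,
    fun i j h => absurd (Subsingleton.elim i j) h⟩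

variable [MetricSpace X] [CompleteSpace X] [MulAction Γ X] [IsIsometricSMul Γ X]

theorem exists_fixed_of_splitsNormalizing (hX : HasCNMidpoints X) {S₁ S₂ : Set Γ}
    (hS : Subgroup.closure S₁ ≤ Subgroup.normalizer (Subgroup.closure S₂ : Set Γ))
    (h₁ : ∃ p : X, ∀ s ∈ S₁, s • p = p) (h₂ : ∃ p : X, ∀ s ∈ S₂, s • p = p) :
    ∃ p : X, ∀ s ∈ S₁ ∪ S₂, s • p = p := by
  obtain ⟨p, hp⟩ := h₁
  obtain ⟨q, hq⟩ := h₂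
  have hC : IsClosedCNConvex (⋂ s : S₂, MulAction.fixedBy X (s : Γ)) :=
    IsClosedCNConvex.iInter fun s => isClosedCNConvex_fixedBy (s : Γ)
  obtain ⟨b, hb, hb'⟩ := hC.exists_fixed hX ⟨q, mem_iInter.2 fun s => hq s s.2⟩ hp (by
    intro t ht x hx
    refine mem_iInter.2 fun s => ?_
    have hx' : ∀ s ∈ S₂, s • x = x := fun s hs => mem_iInter.1 hx ⟨s, hs⟩
    have h1 : t⁻¹ * s * t ∈ Subgroup.closure S₂ := by
      have h2 := Subgroup.mem_normalizer_iff.1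
        (inv_mem (hS (Subgroup.subset_closure ht))) (s : Γ)
      simpa using h2.1 (Subgroup.subset_closure s.2)
    have h3 := smul_eq_of_mem_closure hx' h1
    rw [mul_smul, mul_smul, inv_smul_eq_iff] at h3
    exact h3)
  refine ⟨b, fun s hs => hs.elim (hb' s) fun h => mem_iInter.1 hb ⟨s, h⟩⟩

/-- Each new family commutes with the earlier ones, so it preserves their common fixed set, onto
which its own fixed point is projected. -/
theorem exists_fixed_of_commuting_families (hX : HasCNMidpoints X) {ι : Type*}
    {T : ι → Set Γ} (hT : ∀ i j, i ≠ j → ∀ a ∈ T i, ∀ b ∈ T j, Commute a b)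
    (hfix : ∀ i, ∃ p : X, ∀ t ∈ T i, t • p = p) [Nonempty X] (I : Finset ι) :
    ∃ p : X, ∀ i ∈ I, ∀ t ∈ T i, t • p = p := by
  classical
  induction I using Finset.induction_on with
  | empty => exact ⟨Classical.arbitrary X, by simp⟩
  | insert i I hi ih =>
    obtain ⟨q, hq⟩ := ih
    obtain ⟨p, hp⟩ := hfix i
    have hC : IsClosedCNConvex (⋂ j : I, ⋂ t : T j, MulAction.fixedBy X (t : Γ)) :=
      IsClosedCNConvex.iInter fun j => IsClosedCNConvex.iInter fun t =>
        isClosedCNConvex_fixedBy (t : Γ)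
    obtain ⟨b, hb, hb'⟩ := hC.exists_fixed hX
      ⟨q, mem_iInter₂.2 fun j t => hq j j.2 t t.2⟩ hp (by
        intro t ht x hx
        refine mem_iInter₂.2 fun j s => ?_
        have hx' : (s : Γ) • x = x := mem_iInter₂.1 hx j s
        have hij : i ≠ j := fun h => hi (h ▸ j.2)
        rw [MulAction.mem_fixedBy, smul_smul, ← (hT i j hij t ht s s.2).eq, mul_smul, hx'])
    refine ⟨b, fun j hj t ht => ?_⟩
    rcases Finset.mem_insert.1 hj with rfl | hj
    · exact hb' t ht
    · exact mem_iInter₂.1 hb ⟨j, hj⟩ ⟨t, ht⟩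

theorem exists_fixed_of_hasCommutingConjugates (hX : HasCNMidpoints X) {d n l : ℕ}
    (hdim : DimLE X d) (hd : d < n * l) {S : Finset Γ} (hS : S.card = l + 1)
    (hconj : HasCommutingConjugates (Subgroup.closure (S : Set Γ)) n)
    (hfix : ∀ T : Finset Γ, T ⊆ S → T.card < S.card → ∃ p : X, ∀ t ∈ T, t • p = p) :
    ∃ p : X, ∀ s ∈ S, s • p = p := by
  classical
  obtain ⟨L, -, hL, hcomm⟩ := hconj
  choose g hg using hL
  let e := S.equivFinOfCardEq hS
  let s : Fin (l + 1) → Γ := fun j => e.symm j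
  have hsS : ∀ j, s j ∈ S := fun j => (e.symm j).2
  let a : Fin n → Fin (l + 1) → Γ := fun i j => g i * s j * (g i)⁻¹
  have haL : ∀ i j, a i j ∈ L i := fun i j => by
    rw [hg i]
    exact ⟨s j, Subgroup.subset_closure (hsS j), rfl⟩
  have : Nonempty X := by
    obtain ⟨p, -⟩ := hfix ∅ (Finset.empty_subset S) (by rw [hS]; simp)
    exact ⟨p⟩
  obtain ⟨i, p, hp⟩ := exists_iInter_nonempty_of_dimLE hX hdim hd
    -- Omitting one generator from each conjugate leaves conjugates of proper subsets of `S`, fixed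
    -- by translates of the points from `hfix`.
    (C := fun i j => MulAction.fixedBy X (a i j)) (fun i j => isClosedCNConvex_fixedBy _) (by
      intro α
      obtain ⟨p, hp⟩ := exists_fixed_of_commuting_families (X := X) hX
        (T := fun i => a i '' {j | j ≠ α i}) (by
          rintro i i' hi _ ⟨j, -, rfl⟩ _ ⟨j', -, rfl⟩
          exact hcomm i i' hi _ (haL i j) _ (haL i' j')) (by
          intro i
          obtain ⟨q, hq⟩ := hfix (S.erase (s (α i))) (Finset.erase_subset _ _)
            (Finset.card_erase_lt_of_mem (hsS _))
          refine ⟨g i • q, ?_⟩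
          rintro _ ⟨j, hj, rfl⟩
          have hne : s j ≠ s (α i) := fun h => hj (e.symm.injective (Subtype.ext h))
          have := hq (s j) (Finset.mem_erase.2 ⟨hne, hsS j⟩)
          simp only [a, smul_smul, inv_mul_cancel_right]
          rw [mul_smul, this]) Finset.univ
      refine ⟨p, mem_iInter.2 fun i => mem_iInter₂.2 fun j hj => ?_⟩
      exact hp i (Finset.mem_univ i) _ ⟨j, hj, rfl⟩)
  refine ⟨(g i)⁻¹ • p, fun t ht => ?_⟩
  have h1 : a i (e ⟨t, ht⟩) • p = p := mem_iInter.1 hp _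
  simp only [a, s, Equiv.symm_apply_apply, mul_smul] at h1
  exact eq_inv_smul_iff.2 h1

end FixedPoints

theorem theoremt {Γ : Type*} [Group Γ] {X : Type*} [MetricSpace X] [CompleteSpace X]
    (hX : IsCAT0 X) [MulAction Γ X] [IsIsometricSMul Γ X]
    (d k₀ : ℕ) (hd : 0 < d) (hk₀ : 0 < k₀) (hdim : DimLE X d)
    (Λ : Subgroup Γ) (A : Finset Γ) (hA : Subgroup.closure (A : Set Γ) = Λ)
    (hample : HasAmpleDuplication A d k₀)
    (hfix : ∀ S : Finset Γ, S ⊆ A → S.card ≤ k₀ →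
      (MulAction.fixedPoints (Subgroup.closure (S : Set Γ)) X).Nonempty) :
    (MulAction.fixedPoints Λ X).Nonempty := by
  classical
  obtain ⟨f, hsplit, hf⟩ := hample
  have hCN := hX.hasCNMidpoints
  have key : ∀ m : ℕ, ∀ S : Finset Γ, S ⊆ A → S.card = m → ∃ p : X, ∀ s ∈ S, s • p = p := by
    intro m
    induction m using Nat.strong_induction_on with
    | _ m ih =>
      rintro S hSA rfl
      have ihS : ∀ T : Finset Γ, T ⊆ S → T.card < S.card → ∃ p : X, ∀ t ∈ T, t • p = p :=
        fun T hT hlt => ih T.card hlt T (hT.trans hSA) rfl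
      rcases le_or_gt S.card k₀ with hk | hk
      · exact fixedPoints_closure_nonempty_iff.1 (hfix S hSA hk)
      obtain ⟨l, hl⟩ : ∃ l, S.card = l + 1 := Nat.exists_eq_succ_of_ne_zero (by lia)
      -- Ample duplication is needed only up to size d + 1: beyond it l > d, and a single conjugate
      -- suffices.
      rcases le_or_gt S.card (d + 1) with hkd | hkd
      · rcases hsplit S hSA hk with ⟨S₁, S₂, hS₁, hS₂, hdisj, hSeq, hnorm⟩ | hconj
        · have hproper : ∀ T U : Set Γ, U.Nonempty → Disjoint T U → (S : Set Γ) = T ∪ U →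
              ∃ p : X, ∀ s ∈ T, s • p = p := by
            rintro T U ⟨y, hy⟩ hTU hS
            have hmem : ∀ x, x ∈ S ↔ x ∈ T ∨ x ∈ U := fun x => by
              rw [← Finset.mem_coe, hS, mem_union]
            obtain ⟨p, hp⟩ := ihS (S.filter (· ∈ T)) (Finset.filter_subset _ _)
              (Finset.card_lt_card (Finset.filter_ssubset.2
                ⟨y, (hmem y).2 (Or.inr hy), fun h => disjoint_left.1 hTU h hy⟩))
            exact ⟨p, fun s hs => hp s (Finset.mem_filter.2 ⟨(hmem s).2 (Or.inl hs), hs⟩)⟩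
          obtain ⟨p, hp⟩ := exists_fixed_of_splitsNormalizing hCN hnorm
            (hproper S₁ S₂ hS₂ hdisj hSeq)
            (hproper S₂ S₁ hS₁ hdisj.symm (hSeq.trans (union_comm _ _)))
          exact ⟨p, fun s hs => hp s (hSeq ▸ Finset.mem_coe.2 hs)⟩
        · have hlt := hf S.card hk (le_min hkd (Finset.card_le_card hSA))
          refine exists_fixed_of_hasCommutingConjugates hCN hdim ?_ hl hconj ihS
          rw [hl, Nat.add_sub_cancel, mul_comm] at hlt
          rwa [hl]
      · exact exists_fixed_of_hasCommutingConjugates hCN hdim (n := 1) (by lia) hl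
          (hasCommutingConjugates_one _) ihS
  rw [← hA]
  exact fixedPoints_closure_nonempty_iff.2 (key A.card A subset_rfl rfl)
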